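/- **Setting.** Let $\bar{\mathsf Z}=\{\bar z_1,\dots,\bar z_N\}$, $\tilde{\mathsf Z}=\{\tilde z_1,\dots,\tilde z_M\}$, let $\bar P=(\bar p_{ij})$ and $\tilde P=(\tilde p_{jk})$ be stochastic matrices on them, and let $Z_t=(\bar Z_t,\tilde Z_t)$ be the Markov chain on $\mathsf Z=\bar{\mathsf Z}\times\tilde{\mathsf Z}$ with independent components and transition matrix $P=\bar P\otimes\tilde P$; write $z_{ij}=(\bar z_i,\tilde z_j)$. Let the innovations be i.i.d. with law $\pi$ on a measurable space, independent of the chain. The discount factor, gross return and income are $\hat\beta=\beta(Z,\hat Z,\hat\epsilon)$, $\hat R=R(Z,\hat Z,\hat\epsilon)$, $\hat Y=Y(Z,\hat Z,\hat\epsilon)$ with $\beta,R,Y\ge 0$ measurable and finite-valued; hats denote next-period values, $\mathbb E_z=\mathbb E[\,\cdot\mid Z=z]$, and $\mathbb P_{(z,\hat z)}$ is conditional probability given $(Z,\hat Z)=(z,\hat z)$ (that is, the law of $\hat\epsilon$ with $(z,\hat z)$ inserted). The utility function is $u(c,z_{ij})=c^{1-\gamma_i}/(1-\gamma_i)$ if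 $\gamma_i\ne1$ and $\log c$ if $\gamma_i=1$, where $0<\gamma_1<\dots<\gamma_N$; $u'$ is the derivative in $c$, with $u'(0,z)=\infty$. For a square matrix $A$ with entries in $[0,\infty]$, $r(A)$ is its spectral radius if all entries are finite, and $r(A)=\infty$ otherwise; $A$ is reducible if some simultaneous permutation of its rows and columns makes it block upper triangular with two square diagonal blocks of size at least one, and irreducible otherwise. Assume that $\mathbb E_z u'(\hat Y,\hat Z)<\infty$ and $\mathbb E_z\hat\beta\hat R\,u'(\hat Y,\hat Z)<\infty$ for all $z\in\mathsf Z$, and that $r(K)<1$ for $K_{z\hat z}=P(z,\hat z)\int\beta(z,\hat z,\epsilon)R(z,\hat z,\epsilon)\,\pi(d\epsilon)$ (with $0\cdot\infty=0$). Let $\mathcal C$ be the set of continuous $c:(0,\infty)\times\mathsf Z\to\mathbb R_+$ that are increasing (in the weak sense) in $w$, satisfy $0<c(w,z)\le w$, and have $\sup_{w,z}|u'(c(w,z),z)-u'(w,z)|<\infty$. For $c\in\mathcal C$ let $Tc(w,z)$ be the $\xi\in(0,w]$ that solves $$u'(\xi,z)=\max\Bigl\{\mathbb E_z\,\hat\beta\hat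 R\,u'\bigl(c(\hat R(w-\xi)+\hat Y,\hat Z),\hat Z\bigr),\;u'(w,z)\Bigr\},$$ and let the optimal consumption function $c^*$ be the fixed point of $T$ in $\mathcal C$. For each $i$ let $Q_i(j,k)=\mathbb E\,\beta(z_{ij},z_{ik},\hat\epsilon)R(z_{ij},z_{ik},\hat\epsilon)^{1-\gamma_i}\in[0,\infty]$ and $G_i=\bar p_{ii}(\tilde P\circ Q_i)$, where $\circ$ is the entrywise product, $R^{1-\gamma_i}$ is read as $0$ where $R=0$, and $0\cdot\infty=0$. **Theorem (zero asymptotic MPCs).** Fix $i\in\{1,\dots,N\}$ and suppose that either 1. $\sum_{\ell=1}^{i-1}\bar p_{i\ell}>0$ and $\mathbb P_{(z,\hat z)}(\hat\beta\hat R>0)>0$ for all $z,\hat z\in\mathsf Z$, or 2. $\bar p_{ii}>0$, $G_i$ is irreducible, and $r(G_i)\ge1$. Then $\displaystyle\lim_{w\to\infty}\frac{c^*(w,z_{ij})}{w}=0$ for all $j=1,\dots,M$. -/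

import Mathlib

open MeasureTheory Filter Topology
open scoped NNReal ENNReal

/-- An optimal savings problem with a finite exogenous state space `Z`: a stochastic matrix `P`,
i.i.d. innovations with law `innov`, nonnegative discount factors `β`, gross returns `R` and
non-financial incomes `Y`, all functions of (current state, next state, next innovation), and a
state-dependent utility function `u c z`. -/
structure SavingsProblem (Z E : Type*) [Fintype Z] [DecidableEq Z] [MeasurableSpace E] where
  P : Matrix Z Z ℝ
  P_stochastic : P ∈ Matrix.rowStochastic ℝ Z
  innov : Measure E
  innov_prob : IsProbabilityMeasure innov
  β : Z → Z → E → ℝ≥0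
  R : Z → Z → E → ℝ≥0
  Y : Z → Z → E → ℝ≥0
  measurable_β : ∀ z z', Measurable (β z z')
  measurable_R : ∀ z z', Measurable (R z z')
  measurable_Y : ∀ z z', Measurable (Y z z')
  u : ℝ → Z → ℝ

/-- The spectral radius (largest modulus of a complex eigenvalue) of a square matrix with entries
in `[0, ∞]`; it is `∞` if the matrix has an infinite entry. -/
noncomputable def specRad {n : Type*} [Fintype n] [DecidableEq n] (A : Matrix n n ℝ≥0∞) : ℝ≥0∞ :=
  open Classical in
  if ∃ i j, A i j = ∞ then ∞
  else spectralRadius ℂ (A.map fun a => (a.toReal : ℂ))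

/-- A square matrix is reducible if simultaneously permuting its rows and columns makes it block
upper triangular with two square diagonal blocks, of sizes `m ≥ 1` and `n - m ≥ 1`. -/
def IsReducibleMatrix {α : Type*} [Zero α] {n : ℕ} (A : Matrix (Fin n) (Fin n) α) : Prop :=
  ∃ (σ : Equiv.Perm (Fin n)) (m : ℕ), 0 < m ∧ m < n ∧
    ∀ a b : Fin n, m ≤ (a : ℕ) → (b : ℕ) < m → A (σ a) (σ b) = 0

namespace SavingsProblem

variable {Z E : Type*} [Fintype Z] [DecidableEq Z] [MeasurableSpace E]

/-- The conditional expectation `𝔼_z f(Ẑ, ε̂)` of a `[0, ∞]`-valued function of the next state and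
the next innovation, given that the current state is `z`. -/
noncomputable def condExp (S : SavingsProblem Z E) (z : Z) (f : Z → E → ℝ≥0∞) : ℝ≥0∞ :=
  ∑ z', ENNReal.ofReal (S.P z z') * ∫⁻ ε, f z' ε ∂S.innov

/-- The marginal utility `u'(x, z)` as a number in `[0, ∞]`, with `u'(0, z) = ∞`. -/
noncomputable def margU (S : SavingsProblem Z E) (x : ℝ) (z : Z) : ℝ≥0∞ :=
  if x ≤ 0 then ∞ else ENNReal.ofReal (deriv (fun y => S.u y z) x)

/-- The matrix `K(θ)`. -/
noncomputable def K (S : SavingsProblem Z E) (θ : ℝ) : Matrix Z Z ℝ≥0∞ := fun z z' =>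
  ENNReal.ofReal (S.P z z') *
    ∫⁻ ε, (S.β z z' ε : ℝ≥0∞) * (S.R z z' ε : ℝ≥0∞) ^ θ ∂S.innov

/-- The standing assumption: `𝔼_z u'(Ŷ, Ẑ) < ∞` and `𝔼_z β̂ R̂ u'(Ŷ, Ẑ) < ∞` for all `z`,
and `r(K(1)) < 1`. -/
structure StandingAssumption (S : SavingsProblem Z E) : Prop where
  margU_income : ∀ z, S.condExp z (fun z' ε => S.margU (S.Y z z' ε) z') < ∞
  discounted_margU_income : ∀ z, S.condExp z (fun z' ε =>
    (S.β z z' ε : ℝ≥0∞) * (S.R z z' ε : ℝ≥0∞) * S.margU (S.Y z z' ε) z') < ∞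
  specRad_lt_one : specRad (S.K 1) < 1

/-- The class `𝒞` of candidate consumption functions on `(0, ∞) × Z` (values of `c` at
nonpositive wealth are irrelevant). -/
structure IsCandidate (S : SavingsProblem Z E) (c : ℝ → Z → ℝ) : Prop where
  continuousOn : ∀ z, ContinuousOn (fun w => c w z) (Set.Ioi 0)
  monotoneOn : ∀ z, MonotoneOn (fun w => c w z) (Set.Ioi 0)
  pos : ∀ w z, 0 < w → 0 < c w z
  le_wealth : ∀ w z, 0 < w → c w z ≤ w
  margU_bdd : ∃ B : ℝ, ∀ w z, 0 < w →
    |deriv (fun y => S.u y z) (c w z) - deriv (fun y => S.u y z) w| ≤ B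

/-- `ξ` is the value at `(w, z)` of the image of `c` under the time iteration operator `T`:
`ξ ∈ (0, w]` and
`u'(ξ, z) = max {𝔼_z β̂ R̂ u'(c(R̂ (w - ξ) + Ŷ, Ẑ), Ẑ), u'(w, z)}`. -/
def IsTimeIterationValue (S : SavingsProblem Z E) (c : ℝ → Z → ℝ) (w : ℝ) (z : Z) (ξ : ℝ) :
    Prop :=
  0 < ξ ∧ ξ ≤ w ∧
    S.margU ξ z =
      max (S.condExp z fun z' ε => (S.β z z' ε : ℝ≥0∞) * (S.R z z' ε : ℝ≥0∞) *
            S.margU (c ((S.R z z' ε : ℝ) * (w - ξ) + (S.Y z z' ε : ℝ)) z') z')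
        (S.margU w z)

/-- `c` is the optimal consumption function `c*`: the fixed point in `𝒞` of the time iteration
operator. -/
def IsOptimalConsumption (S : SavingsProblem Z E) (c : ℝ → Z → ℝ) : Prop :=
  S.IsCandidate c ∧ ∀ w z, 0 < w → S.IsTimeIterationValue c w z (c w z)

end SavingsProblem

/-- The constant relative risk aversion utility with risk aversion `γ`. -/
noncomputable def crraUtility (γ c : ℝ) : ℝ :=
  if γ = 1 then Real.log c else c ^ (1 - γ) / (1 - γ)

/-- The Kronecker product of two stochastic matrices is stochastic. -/
theorem kronecker_mem_rowStochastic {m n : Type*} [Fintype m] [DecidableEq m] [Fintype n]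
    [DecidableEq n] {A : Matrix m m ℝ} {B : Matrix n n ℝ} (hA : A ∈ Matrix.rowStochastic ℝ m)
    (hB : B ∈ Matrix.rowStochastic ℝ n) :
    Matrix.kronecker A B ∈ Matrix.rowStochastic ℝ (m × n) := by
  rw [Matrix.mem_rowStochastic_iff_sum] at *
  refine ⟨fun i j => mul_nonneg (hA.1 _ _) (hB.1 _ _), fun i => ?_⟩
  simp only [Matrix.kronecker, Matrix.kroneckerMap_apply]
  rw [Fintype.sum_prod_type]
  simp [← Finset.mul_sum, hA.2, hB.2]

/-- A savings problem with risk aversion shocks: the exogenous state is a pair `(z̄ᵢ, z̃ⱼ)` of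
independent Markov chains with transition matrices `Pbar`, `Ptilde`, and the relative risk
aversion `γ i` depends on, and is strictly increasing in, the first component only. -/
structure RiskAversionModel (N M : ℕ) (E : Type*) [MeasurableSpace E] where
  Pbar : Matrix (Fin N) (Fin N) ℝ
  Ptilde : Matrix (Fin M) (Fin M) ℝ
  Pbar_stochastic : Pbar ∈ Matrix.rowStochastic ℝ (Fin N)
  Ptilde_stochastic : Ptilde ∈ Matrix.rowStochastic ℝ (Fin M)
  γ : Fin N → ℝ
  γ_pos : ∀ i, 0 < γ i
  γ_strictMono : StrictMono γ
  innov : Measure E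
  innov_prob : IsProbabilityMeasure innov
  β : Fin N × Fin M → Fin N × Fin M → E → ℝ≥0
  R : Fin N × Fin M → Fin N × Fin M → E → ℝ≥0
  Y : Fin N × Fin M → Fin N × Fin M → E → ℝ≥0
  measurable_β : ∀ z z', Measurable (β z z')
  measurable_R : ∀ z z', Measurable (R z z')
  measurable_Y : ∀ z z', Measurable (Y z z')

namespace RiskAversionModel

variable {N M : ℕ} {E : Type*} [MeasurableSpace E]

/-- The associated savings problem, with transition matrix `Pbar ⊗ Ptilde` and CRRA utility. -/
noncomputable def toSavingsProblem (A : RiskAversionModel N M E) :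
    SavingsProblem (Fin N × Fin M) E where
  P := Matrix.kronecker A.Pbar A.Ptilde
  P_stochastic := kronecker_mem_rowStochastic A.Pbar_stochastic A.Ptilde_stochastic
  innov := A.innov
  innov_prob := A.innov_prob
  β := A.β
  R := A.R
  Y := A.Y
  measurable_β := A.measurable_β
  measurable_R := A.measurable_R
  measurable_Y := A.measurable_Y
  u := fun c z => crraUtility (A.γ z.1) c

/-- `Qᵢ(j, k) = 𝔼 β(zᵢⱼ, zᵢₖ, ε̂) R(zᵢⱼ, zᵢₖ, ε̂)^(1 - γᵢ) ∈ [0, ∞]`. The power stands for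
`R * R^(-γᵢ)` as it appears in the Euler equation, so that it is read as `0` where `R = 0`. -/
noncomputable def Q (A : RiskAversionModel N M E) (i : Fin N) :
    Matrix (Fin M) (Fin M) ℝ≥0∞ := fun j k =>
  ∫⁻ ε, (A.β (i, j) (i, k) ε : ℝ≥0∞) *
    (if A.R (i, j) (i, k) ε = 0 then 0
      else (A.R (i, j) (i, k) ε : ℝ≥0∞) ^ (1 - A.γ i)) ∂A.innov

/-- `Gᵢ = p̄ᵢᵢ (P̃ ∘ Qᵢ)`, with the entrywise product. -/
noncomputable def G (A : RiskAversionModel N M E) (i : Fin N) :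
    Matrix (Fin M) (Fin M) ℝ≥0∞ := fun j k =>
  ENNReal.ofReal (A.Pbar i i) * (ENNReal.ofReal (A.Ptilde j k) * A.Q i j k)

end RiskAversionModel

/-! In both cases, bound the marginal utility of consumption from below by the Euler inequality and
multiply by `w ^ γᵢ`. The left side becomes `(c/w) ^ (-γᵢ)`, so large lower bounds force a small
consumption rate.

Under the first alternative, a less risk-averse state `l < i` is reached with positive probability.
Since `c ≤ w`, next-period marginal utility there is at least of order `w ^ (-γ l)`. The normalised
bound is thus a positive constant times `w ^ (γ i - γ l)`, which diverges
(`tendsto_zero_of_lower_risk_aversion`).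

Under the second, let `αⱼ` be the limsup of `c(w, zᵢⱼ)/w` and `xⱼ = αⱼ ^ (-γᵢ)`. Keep only
transitions that preserve `i` and apply Fatou along wealth levels where the rate is close to `αⱼ`.
If `αⱼ > 0`, the share saved stays below one, which gives `κ (Gᵢ x)ⱼ ≤ xⱼ` for some `κ > 1`
(`exists_mul_sum_G_le`). If every `αⱼ` were positive, then `Gᵢ x < x` with `x` positive and finite,
so `r(Gᵢ) < 1`, a contradiction. Hence some `αⱼ` vanishes, and irreducibility spreads this to all
`j` (`asymptoticRate_eq_zero`). -/

theorem deriv_crraUtility (γ x : ℝ) :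
    deriv (fun y => crraUtility γ y) x = x ^ (-γ) := by
  by_cases h : γ = 1
  · subst h
    simp [crraUtility, Real.rpow_neg_one]
  · have h' : 1 - γ ≠ 0 := sub_ne_zero.mpr (Ne.symm h)
    simp only [crraUtility, if_neg h]
    rw [deriv_div_const, Real.deriv_rpow_const]
    field_simp
    congr 1
    ring

theorem ENNReal.rpow_neg_le_rpow_neg {x y : ℝ≥0∞} {p : ℝ} (hp : 0 ≤ p) (h : x ≤ y) :
    y ^ (-p) ≤ x ^ (-p) := by
  rw [ENNReal.rpow_neg, ENNReal.rpow_neg]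
  exact ENNReal.inv_le_inv.mpr (ENNReal.rpow_le_rpow h hp)

/-! ### Marginal utility and the Euler inequality -/

namespace RiskAversionModel

variable {N M : ℕ} {E : Type*} [MeasurableSpace E] (A : RiskAversionModel N M E)

/-- The convention `u'(0, z) = ∞` is automatic in this form, since a negative power of `0` in `ℝ≥0∞`
is `∞`. -/
theorem margU_toSavingsProblem (x : ℝ) (z : Fin N × Fin M) :
    A.toSavingsProblem.margU x z = ENNReal.ofReal x ^ (-A.γ z.1) := by
  unfold SavingsProblem.margU
  have hγ := A.γ_pos z.1
  split_ifs with hx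
  · rw [ENNReal.ofReal_of_nonpos hx, ENNReal.zero_rpow_of_neg (by linarith)]
  · have hx : 0 < x := not_le.mp hx
    rw [ENNReal.ofReal_rpow_of_pos hx]
    congr 1
    exact deriv_crraUtility _ _

/-- Income is almost surely positive after every transition of positive probability. -/
theorem ae_income_pos (hA : A.toSavingsProblem.StandingAssumption) {z z' : Fin N × Fin M}
    (hP : 0 < A.toSavingsProblem.P z z') : ∀ᵐ ε ∂A.innov, 0 < A.Y z z' ε := by
  have h := hA.margU_income z
  rw [SavingsProblem.condExp, ENNReal.sum_lt_top] at h
  have h := h z' (Finset.mem_univ _)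
  have hfin : ∫⁻ ε, A.toSavingsProblem.margU (A.Y z z' ε) z' ∂A.innov ≠ ∞ := by
    intro h'
    apply h.ne
    change _ * (∫⁻ ε, A.toSavingsProblem.margU (A.Y z z' ε) z' ∂A.innov) = _
    rw [h']
    exact ENNReal.mul_top (by simpa using hP)
  simp only [margU_toSavingsProblem] at hfin
  have hm : Measurable fun ε => ENNReal.ofReal (A.Y z z' ε : ℝ) ^ (-A.γ z'.1) := by
    have := A.measurable_Y z z'
    fun_prop
  filter_upwards [ae_lt_top hm hfin] with ε hε
  by_contra h0
  have h0 : A.Y z z' ε = 0 := by simpa using h0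
  have hγ := A.γ_pos z'.1
  simp [h0, ENNReal.zero_rpow_of_neg (show -A.γ z'.1 < 0 by linarith)] at hε

/-- A lower bound on the marginal utility of optimal consumption, obtained from the Euler
inequality by bounding savings by `v` and consumption by `g`. -/
theorem sum_lintegral_le_margU (hA : A.toSavingsProblem.StandingAssumption)
    {c : ℝ → Fin N × Fin M → ℝ} (hc : A.toSavingsProblem.IsOptimalConsumption c)
    {w v : ℝ} (hw : 0 < w) (z : Fin N × Fin M) (hv : w - c w z ≤ v)
    (g : Fin N × Fin M → ℝ → ℝ) (hg : ∀ z' y, 0 < y → c y z' ≤ g z' y) :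
    ∑ z', ENNReal.ofReal (A.toSavingsProblem.P z z') *
      ∫⁻ ε, (A.β z z' ε : ℝ≥0∞) * A.R z z' ε *
        ENNReal.ofReal (g z' (A.R z z' ε * v + A.Y z z' ε)) ^ (-A.γ z'.1) ∂A.innov ≤
      ENNReal.ofReal (c w z) ^ (-A.γ z.1) := by
  obtain ⟨-, hle, heq⟩ := hc.2 w z hw
  rw [← margU_toSavingsProblem, heq]
  refine le_trans ?_ (le_max_left _ _)
  refine Finset.sum_le_sum fun z' _ => ?_
  rcases (Matrix.nonneg_of_mem_rowStochastic A.toSavingsProblem.P_stochastic :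
    0 ≤ A.toSavingsProblem.P z z').eq_or_lt with hP | hP
  · simp [← hP]
  refine mul_le_mul_right (lintegral_mono_ae ?_) _
  -- Positive income keeps next-period wealth positive even if `R` or savings vanish; monotonicity
  -- of `c` and the bound `g` are available only there.
  filter_upwards [A.ae_income_pos hA hP] with ε hY
  rw [margU_toSavingsProblem]
  refine mul_le_mul_right ?_ _
  refine ENNReal.rpow_neg_le_rpow_neg (A.γ_pos z'.1).le ?_
  refine ENNReal.ofReal_le_ofReal ?_
  have hY' : (0 : ℝ) < A.Y z z' ε := by exact_mod_cast hY
  have h1 : 0 < (A.R z z' ε : ℝ) * (w - c w z) + A.Y z z' ε := by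
    have : 0 ≤ (A.R z z' ε : ℝ) * (w - c w z) := mul_nonneg (by positivity) (by linarith)
    linarith
  have h2 : (A.R z z' ε : ℝ) * (w - c w z) + A.Y z z' ε ≤ A.R z z' ε * v + A.Y z z' ε := by
    gcongr
  exact (hc.1.monotoneOn z' h1 (h1.trans_le h2) h2).trans (hg _ _ (h1.trans_le h2))

/-! ### Transitions to lower risk aversion -/

theorem ofReal_div_rpow_neg {x w : ℝ} (hw : 0 < w) (p : ℝ) :
    ENNReal.ofReal (x / w) ^ (-p) = ENNReal.ofReal w ^ p * ENNReal.ofReal x ^ (-p) := by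
  rw [ENNReal.ofReal_div_of_pos hw, div_eq_mul_inv, ENNReal.mul_rpow_of_ne_top (by simp) (by simpa),
    ENNReal.inv_rpow, ENNReal.rpow_neg _ p, ENNReal.rpow_neg _ p, inv_inv, mul_comm]

theorem tendsto_div_zero_of_tendsto_rpow {γ : ℝ} (hγ : 0 < γ) {f : ℝ → ℝ}
    (hf : ∀ w, 0 < w → 0 ≤ f w)
    (h : Tendsto (fun w => ENNReal.ofReal (f w) ^ (-γ)) atTop (𝓝 ∞)) :
    Tendsto f atTop (𝓝 0) := by
  have h1 := ((ENNReal.continuous_rpow_const (y := -γ⁻¹)).tendsto ∞).comp h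
  rw [ENNReal.top_rpow_of_neg (by simpa using hγ)] at h1
  have h2 := (ENNReal.tendsto_toReal ENNReal.zero_ne_top).comp h1
  refine h2.congr' ?_
  filter_upwards [eventually_gt_atTop 0] with w hw
  simp only [Function.comp]
  rw [← ENNReal.rpow_mul]
  have : -γ * -γ⁻¹ = 1 := by field_simp
  rw [this, ENNReal.rpow_one, ENNReal.toReal_ofReal (hf w hw)]

theorem tendsto_zero_of_lower_risk_aversion (hA : A.toSavingsProblem.StandingAssumption)
    {c : ℝ → Fin N × Fin M → ℝ} (hc : A.toSavingsProblem.IsOptimalConsumption c) {i l : Fin N}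
    {j k : Fin M} (hli : l < i) (hP : 0 < A.toSavingsProblem.P (i, j) (l, k))
    (hpos : 0 < A.innov {ε | 0 < A.β (i, j) (l, k) ε * A.R (i, j) (l, k) ε}) :
    Tendsto (fun w : ℝ => c w (i, j) / w) atTop (𝓝 0) := by
  have hγ := A.γ_strictMono hli
  have hγl := A.γ_pos l
  refine tendsto_div_zero_of_tendsto_rpow (A.γ_pos i)
    (fun w hw => div_nonneg (hc.1.pos w _ hw).le hw.le) ?_
  have := A.measurable_Y (i, j) (l, k)
  have := A.measurable_R (i, j) (l, k)
  have := A.measurable_β (i, j) (l, k)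
  -- For `w ≥ 1`, `R w + Y ≤ w (R + Y)`, so the power of `w` factors out of the Euler term and
  -- leaves `C`. It may be infinite; only `C ≠ 0` matters.
  set C : ℝ≥0∞ := ENNReal.ofReal (A.toSavingsProblem.P (i, j) (l, k)) *
    ∫⁻ ε, (A.β (i, j) (l, k) ε : ℝ≥0∞) * A.R (i, j) (l, k) ε *
        ENNReal.ofReal (A.R (i, j) (l, k) ε + A.Y (i, j) (l, k) ε) ^ (-A.γ l) ∂A.innov with hC
  have hC0 : C ≠ 0 := by
    refine mul_ne_zero (by simpa using hP) ?_
    rw [← pos_iff_ne_zero, lintegral_pos_iff_support (by fun_prop)]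
    refine hpos.trans_le (measure_mono fun ε hε => ?_)
    have hε : 0 < A.β (i, j) (l, k) ε * A.R (i, j) (l, k) ε := hε
    have h1 := pos_of_mul_pos_left hε zero_le
    have h2 := pos_of_mul_pos_right hε zero_le
    simp only [Function.mem_support]
    refine mul_ne_zero (mul_ne_zero (by simpa using h1.ne') (by simpa using h2.ne')) ?_
    rw [ENNReal.rpow_neg, Ne, ENNReal.inv_eq_zero, ENNReal.rpow_eq_top_iff_of_pos hγl]
    simp
  have hlim : Tendsto (fun w : ℝ => ENNReal.ofReal w ^ (A.γ i - A.γ l) * C) atTop (𝓝 ∞) := by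
    have h1 := ((ENNReal.continuous_rpow_const (y := A.γ i - A.γ l)).tendsto ∞).comp
      ENNReal.tendsto_ofReal_atTop
    rw [ENNReal.top_rpow_of_pos (by linarith)] at h1
    have h2 := ENNReal.Tendsto.mul_const (b := C) h1 (Or.inl ENNReal.top_ne_zero)
    rwa [ENNReal.top_mul hC0] at h2
  refine tendsto_nhds_top_mono hlim ?_
  filter_upwards [eventually_ge_atTop 1] with w hw1
  have hw : 0 < w := by linarith
  have hE := A.sum_lintegral_le_margU hA hc hw (i, j) (v := w)
    (by linarith [hc.1.pos w (i, j) hw]) (fun _ y => y) (fun z' y hy => hc.1.le_wealth y z' hy)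
  have hE := (Finset.single_le_sum (fun _ _ => zero_le) (Finset.mem_univ (l, k))).trans hE
  rw [ofReal_div_rpow_neg hw, ENNReal.rpow_sub _ _ (by simpa using hw) (by simp), div_eq_mul_inv,
    mul_assoc]
  refine mul_le_mul_right (le_trans ?_ hE) _
  rw [← ENNReal.rpow_neg, hC, mul_left_comm, ← lintegral_const_mul _ (by fun_prop)]
  refine mul_le_mul_right (lintegral_mono fun ε => ?_) _
  rw [mul_left_comm]
  refine mul_le_mul_right ?_ _
  rw [← ENNReal.mul_rpow_of_ne_top (by simp) (by simp), ← ENNReal.ofReal_mul hw.le]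
  refine ENNReal.rpow_neg_le_rpow_neg hγl.le (ENNReal.ofReal_le_ofReal ?_)
  have hY : (0 : ℝ) ≤ A.Y (i, j) (l, k) ε := NNReal.coe_nonneg _
  change (A.R (i, j) (l, k) ε : ℝ) * w + A.Y (i, j) (l, k) ε ≤ _
  nlinarith

end RiskAversionModel

/-! ### Irreducibility and spectral radius of nonnegative matrices -/

theorem eq_univ_of_not_isReducibleMatrix {α : Type*} [Zero α] {n : ℕ}
    {B : Matrix (Fin n) (Fin n) α} (hB : ¬ IsReducibleMatrix B) {s : Set (Fin n)}
    (hs : s.Nonempty) (h : ∀ a ∉ s, ∀ b ∈ s, B a b = 0) : s = Set.univ := by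
  classical
  by_contra hne
  obtain ⟨a, ha⟩ := (Set.ne_univ_iff_exists_notMem s).mp hne
  obtain ⟨b, hb⟩ := hs
  apply hB
  have hlt : Fintype.card s < n := by
    simpa using Fintype.card_subtype_lt (p := (· ∈ s)) ha
  have hcard : Fintype.card {x : Fin n // (x : ℕ) < Fintype.card s} =
      Fintype.card {x : Fin n // x ∈ s} := by
    rw [Fintype.card_subtype, Fin.card_filter_val_lt, min_eq_right hlt.le]
  -- The permutation lists the elements of `s` first, so the lower left block is indexed by `sᶜ ×
  -- s`.
  let e := Fintype.equivOfCardEq hcard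
  refine ⟨e.extendSubtype, Fintype.card s, Fintype.card_pos_iff.mpr ⟨⟨b, hb⟩⟩, hlt, ?_⟩
  intro x y hx hy
  exact h _ (e.extendSubtype_not_mem x (not_lt.mpr hx)) _ (e.extendSubtype_mem y hy)

/-- An eigenvalue bound for nonnegative matrices from a positive super-eigenvector. -/
theorem norm_le_of_mem_spectrum_of_sum_le {n : Type*} [Fintype n] [DecidableEq n]
    {B : Matrix n n ℝ} (hB : ∀ j k, 0 ≤ B j k) {y : n → ℝ} (hy : ∀ j, 0 < y j) {r : ℝ}
    (h : ∀ j, ∑ k, B j k * y k ≤ r * y j) {μ : ℂ}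
    (hμ : μ ∈ spectrum ℂ (B.map fun a => (a : ℂ))) : ‖μ‖ ≤ r := by
  rw [← Matrix.spectrum_toLin', ← Module.End.hasEigenvalue_iff_mem_spectrum] at hμ
  obtain ⟨v, hv⟩ := hμ.exists_hasEigenvector
  have hv0 := hv.2
  have hev := hv.apply_eq_smul
  obtain ⟨i₀, hi₀⟩ := Function.ne_iff.mp hv0
  have : Nonempty n := ⟨i₀⟩
  -- Measure the eigenvector in the sup norm weighted by `1 / y` and read the eigenvalue equation at
  -- a maximising coordinate.
  obtain ⟨j, hj⟩ := Finite.exists_max fun j => ‖v j‖ / y j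
  set m := ‖v j‖ / y j with hm
  have hm0 : 0 < m := lt_of_lt_of_le (div_pos (norm_pos_iff.mpr hi₀) (hy i₀)) (hj i₀)
  have hvj : ‖v j‖ = m * y j := by rw [hm, div_mul_cancel₀ _ (hy j).ne']
  have hle : ∀ k, ‖v k‖ ≤ m * y k := fun k => (div_le_iff₀ (hy k)).mp (hj k)
  have h1 : μ * v j = ∑ k, (B j k : ℂ) * v k := by
    have := congrFun hev j
    simpa [Matrix.toLin'_apply, Matrix.mulVec, dotProduct] using this.symm
  have h2 : ‖μ‖ * (m * y j) ≤ r * (m * y j) := by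
    calc ‖μ‖ * (m * y j) = ‖∑ k, (B j k : ℂ) * v k‖ := by rw [← h1, norm_mul, hvj]
      _ ≤ ∑ k, ‖(B j k : ℂ) * v k‖ := norm_sum_le _ _
      _ ≤ ∑ k, m * (B j k * y k) := by
          refine Finset.sum_le_sum fun k _ => ?_
          rw [norm_mul, Complex.norm_real, Real.norm_of_nonneg (hB j k)]
          calc B j k * ‖v k‖ ≤ B j k * (m * y k) := mul_le_mul_of_nonneg_left (hle k) (hB j k)
            _ = _ := by ring
      _ = m * ∑ k, B j k * y k := by rw [Finset.mul_sum]
      _ ≤ m * (r * y j) := mul_le_mul_of_nonneg_left (h j) hm0.le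
      _ = r * (m * y j) := by ring
  exact le_of_mul_le_mul_right h2 (mul_pos hm0 (hy j))

theorem specRad_lt_one_of_sum_lt {n : Type*} [Fintype n] [DecidableEq n] {B : Matrix n n ℝ≥0∞}
    {x : n → ℝ≥0∞} (hx0 : ∀ j, x j ≠ 0) (hx : ∀ j, x j ≠ ∞)
    (h : ∀ j, ∑ k, B j k * x k < x j) : specRad B < 1 := by
  -- This excludes the branch of `specRad` with value `∞`.
  have hB : ∀ j k, B j k ≠ ∞ := by
    intro j k hjk
    have h1 := (Finset.single_le_sum (f := fun k => B j k * x k) (fun _ _ => zero_le)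
      (Finset.mem_univ k)).trans_lt (h j)
    simp only [hjk, ENNReal.top_mul (hx0 k)] at h1
    exact not_top_lt h1
  have hy : ∀ j, 0 < (x j).toReal := fun j => ENNReal.toReal_pos (hx0 j) (hx j)
  have hreal : ∀ j, ∑ k, (B j k).toReal * (x k).toReal < (x j).toReal := by
    intro j
    have h1 := (ENNReal.toReal_lt_toReal (h j).ne_top (hx j)).mpr (h j)
    rw [ENNReal.toReal_sum fun k _ => ENNReal.mul_ne_top (hB j k) (hx k)] at h1
    simpa only [ENNReal.toReal_mul] using h1
  -- Finitely many strict inequalities leave room for a common factor `r < 1`.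
  obtain ⟨r, ⟨hr, hr1⟩⟩ : ∃ r : ℝ, (∀ j, ∑ k, (B j k).toReal * (x k).toReal < r * (x j).toReal) ∧
      r < 1 := by
    have h1 : ∀ᶠ r : ℝ in 𝓝[<] 1,
        ∀ j, ∑ k, (B j k).toReal * (x k).toReal < r * (x j).toReal := by
      refine eventually_all.mpr fun j => ?_
      have hc : Tendsto (fun r : ℝ => r * (x j).toReal) (𝓝[<] 1) (𝓝 (1 * (x j).toReal)) :=
        ((continuous_id.mul continuous_const).tendsto 1).mono_left nhdsWithin_le_nhds
      exact hc.eventually (lt_mem_nhds (by simpa using hreal j))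
    exact (h1.and self_mem_nhdsWithin).exists
  rw [specRad, if_neg (by simpa using hB)]
  refine lt_of_le_of_lt ?_ (ENNReal.ofReal_lt_one.mpr hr1)
  refine iSup₂_le fun μ hμ => ?_
  have := norm_le_of_mem_spectrum_of_sum_le (B := B.map ENNReal.toReal) (fun j k => by simp) hy
    (fun j => (hr j).le) (μ := μ) (by rwa [Matrix.map_map])
  rw [← enorm_eq_nnnorm, ← ofReal_norm]
  exact ENNReal.ofReal_le_ofReal this

/-! ### Fatou's lemma in the Euler inequality -/

namespace RiskAversionModel

variable {N M : ℕ} {E : Type*} [MeasurableSpace E] (A : RiskAversionModel N M E)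

theorem tendsto_affine_div {r v y : ℝ} :
    Tendsto (fun w : ℝ => (r * (v * w) + y) / w) atTop (𝓝 (r * v)) := by
  have h : Tendsto (fun w : ℝ => r * v + y / w) atTop (𝓝 (r * v + 0)) :=
    tendsto_const_nhds.add (tendsto_const_nhds.div_atTop tendsto_id)
  rw [add_zero] at h
  refine h.congr' ?_
  filter_upwards [eventually_gt_atTop 0] with w hw
  field_simp

/-- The pointwise limit of the normalised discounted marginal utility when consumption is bounded
by the linear function of slope `a` above `X`. -/
theorem tendsto_discounted_rpow_neg (β R : ℝ≥0) (y X : ℝ) {γ a v : ℝ} (ha : 0 < a) (hv : 0 < v) :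
    Tendsto (fun w : ℝ => (β : ℝ≥0∞) * R * (ENNReal.ofReal w ^ γ *
        ENNReal.ofReal (if X ≤ R * (v * w) + y then a * (R * (v * w) + y)
          else R * (v * w) + y) ^ (-γ))) atTop
      (𝓝 (ENNReal.ofReal v ^ (-γ) * (ENNReal.ofReal a ^ (-γ) *
        ((β : ℝ≥0∞) * (if R = 0 then 0 else (R : ℝ≥0∞) ^ (1 - γ)))))) := by
  rcases eq_or_ne R 0 with hR | hR
  · simp [hR]
  have hR' : (0 : ℝ) < R := by exact_mod_cast pos_iff_ne_zero.mpr hR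
  have hlim : (β : ℝ≥0∞) * R * ENNReal.ofReal (a * (R * v)) ^ (-γ) =
      ENNReal.ofReal v ^ (-γ) * (ENNReal.ofReal a ^ (-γ) *
        ((β : ℝ≥0∞) * (if R = 0 then 0 else (R : ℝ≥0∞) ^ (1 - γ)))) := by
    rw [if_neg hR, ENNReal.ofReal_mul ha.le, ENNReal.ofReal_mul hR'.le,
      ENNReal.mul_rpow_of_ne_top (by simp) (by finiteness),
      ENNReal.mul_rpow_of_ne_top (by simp) (by simp),
      sub_eq_add_neg, ENNReal.rpow_add _ _ (by simpa using hR) (by simp), ENNReal.rpow_one,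
      ENNReal.ofReal_coe_nnreal]
    ring
  rw [← hlim]
  refine ENNReal.Tendsto.const_mul ?_ (Or.inr (by finiteness))
  have h1 : Tendsto (fun w : ℝ => ENNReal.ofReal (a * ((R * (v * w) + y) / w)) ^ (-γ)) atTop
      (𝓝 (ENNReal.ofReal (a * (R * v)) ^ (-γ))) :=
    ((ENNReal.continuous_rpow_const.comp ENNReal.continuous_ofReal).tendsto _).comp
      (tendsto_affine_div.const_mul a)
  refine h1.congr' ?_
  have h2 : Tendsto (fun w : ℝ => R * (v * w) + y) atTop atTop :=
    tendsto_atTop_add_const_right _ _ ((tendsto_id.const_mul_atTop hv).const_mul_atTop hR')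
  filter_upwards [h2.eventually_ge_atTop X, eventually_gt_atTop 0] with w hX hw
  rw [if_pos hX, ← ofReal_div_rpow_neg hw, mul_div_assoc]

/-- Fatou's lemma applied to the Euler inequality along wealth levels at which the consumption
rate exceeds `b`. -/
theorem sum_G_mul_le_of_frequently (hA : A.toSavingsProblem.StandingAssumption)
    {c : ℝ → Fin N × Fin M → ℝ} (hc : A.toSavingsProblem.IsOptimalConsumption c) {i : Fin N}
    {j : Fin M} {b : ℝ} (hb1 : b < 1)
    (hb : ∃ᶠ w in atTop, b < c w (i, j) / w) {a : Fin M → ℝ} (ha : ∀ k, 0 < a k)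
    (hca : ∀ k, ∀ᶠ w in atTop, c w (i, k) ≤ a k * w) :
    ENNReal.ofReal (1 - b) ^ (-A.γ i) * ∑ k, A.G i j k * ENNReal.ofReal (a k) ^ (-A.γ i) ≤
      ENNReal.ofReal b ^ (-A.γ i) := by
  have hγ := A.γ_pos i
  obtain ⟨X, hX⟩ := eventually_atTop.mp (eventually_all.mpr hca)
  have hmY := fun k => A.measurable_Y (i, j) (i, k)
  have hmR := fun k => A.measurable_R (i, j) (i, k)
  have hmβ := fun k => A.measurable_β (i, j) (i, k)
  let p : Fin M → ℝ≥0∞ := fun k => ENNReal.ofReal (A.Pbar i i) * ENNReal.ofReal (A.Ptilde j k)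
  -- The linear bound holds only above `X`; below it the trivial bound `c ≤ w` is used. The
  -- threshold disappears in the limit: wealth diverges where `R > 0`, and the factor `R` kills the
  -- term where `R = 0`.
  let l : Fin M → ℝ → ℝ := fun k y => if X ≤ y then a k * y else y
  have hml : ∀ k, Measurable (l k) := fun k =>
    Measurable.ite measurableSet_Ici (by fun_prop) (by fun_prop)
  let F : Fin M → ℝ → E → ℝ≥0∞ := fun k w ε =>
    (A.β (i, j) (i, k) ε : ℝ≥0∞) * A.R (i, j) (i, k) ε * (ENNReal.ofReal w ^ A.γ i *
      ENNReal.ofReal (l k (A.R (i, j) (i, k) ε * ((1 - b) * w) + A.Y (i, j) (i, k) ε)) ^ (-A.γ i))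
  have hmF : ∀ k w, Measurable (F k w) := fun k w => by
    have := hmY k
    have := hmR k
    have := hmβ k
    have := hml k
    fun_prop
  have hbound : ∃ᶠ w in atTop, ∫⁻ ε, ∑ k, p k * F k w ε ∂A.innov ≤
      ENNReal.ofReal b ^ (-A.γ i) := by
    refine (hb.and_eventually (eventually_gt_atTop 0)).mono ?_
    rintro w ⟨hbw, hw⟩
    have hE := A.sum_lintegral_le_margU hA hc hw (i, j) (v := (1 - b) * w)
      (by have := (lt_div_iff₀ hw).mp hbw; linarith)
      (fun z' y => if z'.1 = i then l z'.2 y else y) (by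
        rintro ⟨i', k⟩ y hy
        dsimp only
        split_ifs with h
        · subst h
          dsimp only [l]
          split_ifs with h'
          · exact hX y h' k
          · exact hc.1.le_wealth y _ hy
        · exact hc.1.le_wealth y _ hy)
    rw [Fintype.sum_prod_type] at hE
    have hE := (Finset.single_le_sum (fun _ _ => zero_le) (Finset.mem_univ i)).trans hE
    simp only [if_true] at hE
    rw [lintegral_finsetSum _ fun k _ => (hmF k w).const_mul _]
    calc ∑ k, ∫⁻ ε, p k * F k w ε ∂A.innov = ENNReal.ofReal w ^ A.γ i * ∑ k, p k *
          ∫⁻ ε, (A.β (i, j) (i, k) ε : ℝ≥0∞) * A.R (i, j) (i, k) ε * ENNReal.ofReal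
          (l k (A.R (i, j) (i, k) ε * ((1 - b) * w) + A.Y (i, j) (i, k) ε)) ^ (-A.γ i)
            ∂A.innov := by
          rw [Finset.mul_sum]
          refine Finset.sum_congr rfl fun k _ => ?_
          have := hmY k
          have := hmR k
          have := hmβ k
          have := hml k
          rw [mul_left_comm, lintegral_const_mul _ (hmF k w),
            ← lintegral_const_mul (ENNReal.ofReal w ^ A.γ i) (by fun_prop)]
          exact congrArg _ (lintegral_congr fun ε => mul_left_comm _ _ _)
      _ ≤ ENNReal.ofReal w ^ A.γ i * ENNReal.ofReal (c w (i, j)) ^ (-A.γ i) := by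
          refine mul_le_mul_right (le_trans (le_of_eq ?_) hE) _
          refine Finset.sum_congr rfl fun k _ => ?_
          congr 1
          change _ = ENNReal.ofReal (A.Pbar i i * A.Ptilde j k)
          rw [ENNReal.ofReal_mul (Matrix.nonneg_of_mem_rowStochastic A.Pbar_stochastic)]
      _ = ENNReal.ofReal (c w (i, j) / w) ^ (-A.γ i) := (ofReal_div_rpow_neg hw _).symm
      _ ≤ _ := ENNReal.rpow_neg_le_rpow_neg hγ.le (ENNReal.ofReal_le_ofReal hbw.le)
  have hfatou := lintegral_liminf_le (μ := A.innov) (u := (atTop : Filter ℝ))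
    (f := fun w ε => ∑ k, p k * F k w ε)
    fun w => Finset.measurable_fun_sum _ fun k _ => (hmF k w).const_mul _
  -- A bound at arbitrarily large `w` already controls the liminf, so no subsequence has to be
  -- extracted.
  refine le_trans (le_of_eq ?_) (hfatou.trans (liminf_le_of_frequently_le' hbound))
  have hlim : ∀ ε, liminf (fun w => ∑ k, p k * F k w ε) atTop =
      ∑ k, p k * (ENNReal.ofReal (1 - b) ^ (-A.γ i) * (ENNReal.ofReal (a k) ^ (-A.γ i) *
        ((A.β (i, j) (i, k) ε : ℝ≥0∞) * (if A.R (i, j) (i, k) ε = 0 then 0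
          else (A.R (i, j) (i, k) ε : ℝ≥0∞) ^ (1 - A.γ i))))) := fun ε => by
    refine Tendsto.liminf_eq (tendsto_finsetSum _ fun k _ => ?_)
    exact ENNReal.Tendsto.const_mul (tendsto_discounted_rpow_neg _ _ _ X (ha k) (by linarith))
      (Or.inr (by finiteness))
  simp only [hlim]
  have hmq : ∀ k, Measurable fun ε => (A.β (i, j) (i, k) ε : ℝ≥0∞) *
      (if A.R (i, j) (i, k) ε = 0 then 0
          else (A.R (i, j) (i, k) ε : ℝ≥0∞) ^ (1 - A.γ i)) := fun k => by
    have := hmR k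
    have := hmβ k
    refine Measurable.mul (by fun_prop) (Measurable.ite ?_ (by fun_prop) (by fun_prop))
    exact hmR k (measurableSet_singleton 0)
  rw [lintegral_finsetSum _ fun k _ => (((hmq k).const_mul _).const_mul _).const_mul _,
    Finset.mul_sum]
  refine Finset.sum_congr rfl fun k _ => ?_
  rw [lintegral_const_mul _ (((hmq k).const_mul _).const_mul _),
    lintegral_const_mul _ ((hmq k).const_mul _), lintegral_const_mul _ (hmq k)]
  simp only [G, Q, p]
  ring

/-! ### Asymptotic consumption rates -/

/-- The upper asymptotic consumption rate out of wealth in the exogenous state `z`. -/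
noncomputable def asymptoticRate (c : ℝ → Fin N × Fin M → ℝ) (z : Fin N × Fin M) : ℝ≥0∞ :=
  limsup (fun w : ℝ => ENNReal.ofReal (c w z / w)) atTop

theorem asymptoticRate_le_one {S : SavingsProblem (Fin N × Fin M) E}
    {c : ℝ → Fin N × Fin M → ℝ} (hc : S.IsCandidate c) (z : Fin N × Fin M) :
    asymptoticRate c z ≤ 1 := by
  refine limsup_le_of_le (by isBoundedDefault) ?_
  filter_upwards [eventually_gt_atTop 0] with w hw
  rw [ENNReal.ofReal_le_one]
  exact (div_le_one hw).mpr (hc.le_wealth w z hw)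

theorem tendsto_div_of_asymptoticRate_eq_zero {S : SavingsProblem (Fin N × Fin M) E}
    {c : ℝ → Fin N × Fin M → ℝ} (hc : S.IsCandidate c) {z : Fin N × Fin M}
    (h : asymptoticRate c z = 0) : Tendsto (fun w : ℝ => c w z / w) atTop (𝓝 0) := by
  have h1 : Tendsto (fun w : ℝ => ENNReal.ofReal (c w z / w)) atTop (𝓝 0) :=
    tendsto_of_le_liminf_of_limsup_le zero_le h.le
  refine ((ENNReal.tendsto_toReal ENNReal.zero_ne_top).comp h1).congr' ?_
  filter_upwards [eventually_gt_atTop 0] with w hw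
  exact ENNReal.toReal_ofReal (div_nonneg (hc.pos w z hw).le hw.le)

/-- The factor `κ` is the gain from consuming a non-negligible share of wealth: savings are then at
most a fraction of `w` bounded away from one. -/
theorem exists_mul_sum_G_le (hA : A.toSavingsProblem.StandingAssumption)
    {c : ℝ → Fin N × Fin M → ℝ} (hc : A.toSavingsProblem.IsOptimalConsumption c) (i : Fin N)
    {j : Fin M} (hj : asymptoticRate c (i, j) ≠ 0) :
    ∃ κ : ℝ≥0∞, 1 < κ ∧ κ * ∑ k, A.G i j k * asymptoticRate c (i, k) ^ (-A.γ i) ≤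
      asymptoticRate c (i, j) ^ (-A.γ i) := by
  have hγ := A.γ_pos i
  have htop : ∀ k, asymptoticRate c (i, k) ≠ ∞ := fun k =>
    ((asymptoticRate_le_one hc.1 (i, k)).trans_lt ENNReal.one_lt_top).ne
  obtain ⟨α, hα⟩ : ∃ α : ℝ, α = (asymptoticRate c (i, j)).toReal := ⟨_, rfl⟩
  have hα0 : 0 < α := hα ▸ ENNReal.toReal_pos hj (htop j)
  have hα1 : α ≤ 1 := by
    rw [hα]
    exact ENNReal.toReal_le_of_le_ofReal zero_le_one
      (by simpa using asymptoticRate_le_one hc.1 (i, j))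
  have hαj : ENNReal.ofReal α = asymptoticRate c (i, j) := by
    rw [hα, ENNReal.ofReal_toReal (htop j)]
  -- Halving `α` gives one factor valid for all `b` in `(α/2, α)`, finite even when `α = 1`, so that
  -- it survives the limit `b → α`.
  refine ⟨ENNReal.ofReal (1 - α / 2) ^ (-A.γ i), ?_, ?_⟩
  · refine ENNReal.one_lt_rpow_of_pos_of_lt_one_of_neg ?_ ?_ (by linarith)
    · simp; linarith
    · simp; linarith
  have key : ∀ b, α / 2 < b → b < α →
      ENNReal.ofReal (1 - α / 2) ^ (-A.γ i) *
        ∑ k, A.G i j k * asymptoticRate c (i, k) ^ (-A.γ i) ≤ ENNReal.ofReal b ^ (-A.γ i) := by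
    intro b hb hbα
    have hfreq : ∃ᶠ w in atTop, b < c w (i, j) / w := by
      have h1 : ENNReal.ofReal b < asymptoticRate c (i, j) := by
        rw [← hαj]
        exact (ENNReal.ofReal_lt_ofReal_iff hα0).mpr hbα
      refine (frequently_lt_of_lt_limsup (by isBoundedDefault) h1).mono fun w hw => ?_
      exact (ENNReal.ofReal_lt_ofReal_iff'.mp hw).1
    refine le_trans (mul_le_mul_left (ENNReal.rpow_neg_le_rpow_neg hγ.le
      (ENNReal.ofReal_le_ofReal (by linarith : 1 - b ≤ 1 - α / 2))) _) ?_
    -- The slack `δ` makes the linear bounds hold eventually and keeps their slopes positive where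
    -- the rate is zero.
    have hδ : ∀ᶠ δ : ℝ in 𝓝[>] 0, ENNReal.ofReal (1 - b) ^ (-A.γ i) *
        ∑ k, A.G i j k * (asymptoticRate c (i, k) + ENNReal.ofReal δ) ^ (-A.γ i) ≤
          ENNReal.ofReal b ^ (-A.γ i) := by
      filter_upwards [self_mem_nhdsWithin] with δ hδ
      have hδ : 0 < δ := hδ
      have h2 := A.sum_G_mul_le_of_frequently hA hc (by linarith) hfreq
        (a := fun k => (asymptoticRate c (i, k)).toReal + δ)
        (fun k => add_pos_of_nonneg_of_pos ENNReal.toReal_nonneg hδ) (fun k => by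
          have h3 : asymptoticRate c (i, k) <
              ENNReal.ofReal ((asymptoticRate c (i, k)).toReal + δ) := by
            rw [ENNReal.ofReal_add ENNReal.toReal_nonneg hδ.le, ENNReal.ofReal_toReal (htop k)]
            exact ENNReal.lt_add_right (htop k) (by simpa using hδ)
          filter_upwards [eventually_lt_of_limsup_lt h3, eventually_gt_atTop 0] with w hw hw0
          exact ((div_lt_iff₀ hw0).mp (ENNReal.ofReal_lt_ofReal_iff'.mp hw).1).le)
      simpa only [ENNReal.ofReal_add ENNReal.toReal_nonneg hδ.le,
        ENNReal.ofReal_toReal (htop _)] using h2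
    refine le_of_tendsto (ENNReal.Tendsto.const_mul (tendsto_finsetSum _ fun k _ => ?_)
      (Or.inr ?_)) hδ
    -- An entry of `G` may be infinite, so continuity of the product needs the limit of the power to
    -- be nonzero, that is, a finite rate.
    · refine ENNReal.Tendsto.const_mul ?_ (Or.inl ?_)
      · have h4 : Tendsto (fun δ : ℝ => asymptoticRate c (i, k) + ENNReal.ofReal δ) (𝓝[>] 0)
            (𝓝 (asymptoticRate c (i, k) + ENNReal.ofReal 0)) :=
          ((continuous_const.add ENNReal.continuous_ofReal).tendsto 0).mono_left nhdsWithin_le_nhds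
        rw [ENNReal.ofReal_zero, add_zero] at h4
        exact (ENNReal.continuous_rpow_const.tendsto _).comp h4
      · rw [ENNReal.rpow_neg, Ne, ENNReal.inv_eq_zero, ENNReal.rpow_eq_top_iff_of_pos hγ]
        exact htop k
    · rw [ENNReal.rpow_neg, Ne, ENNReal.inv_eq_top, ENNReal.rpow_eq_zero_iff_of_pos hγ]
      simp
      linarith
  have hlim : Tendsto (fun b : ℝ => ENNReal.ofReal b ^ (-A.γ i)) (𝓝[<] α)
      (𝓝 (asymptoticRate c (i, j) ^ (-A.γ i))) := by
    rw [← hαj]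
    exact ((ENNReal.continuous_rpow_const.comp ENNReal.continuous_ofReal).tendsto α).mono_left
      nhdsWithin_le_nhds
  refine ge_of_tendsto hlim ?_
  filter_upwards [Ioo_mem_nhdsLT (by linarith : α / 2 < α)] with b hb
  exact key b hb.1 hb.2

theorem asymptoticRate_eq_zero (hA : A.toSavingsProblem.StandingAssumption)
    {c : ℝ → Fin N × Fin M → ℝ} (hc : A.toSavingsProblem.IsOptimalConsumption c) {i : Fin N}
    (hirr : ¬ IsReducibleMatrix (A.G i)) (hrad : 1 ≤ specRad (A.G i)) (j : Fin M) :
    asymptoticRate c (i, j) = 0 := by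
  have hγ := A.γ_pos i
  by_cases hs : ∃ k, asymptoticRate c (i, k) = 0
  -- If rate `a` is positive and rate `b` is zero, then `G a b ≠ 0` would make the left side of the
  -- inequality infinite and the right side finite.
  · have huniv := eq_univ_of_not_isReducibleMatrix hirr
      (s := {k | asymptoticRate c (i, k) = 0}) hs fun a ha b hb => by
        obtain ⟨κ, hκ, hle⟩ := A.exists_mul_sum_G_le hA hc i ha
        have hb : asymptoticRate c (i, b) = 0 := hb
        have ha : asymptoticRate c (i, a) ≠ 0 := ha
        by_contra hG
        have h1 : ∑ k, A.G i a k * asymptoticRate c (i, k) ^ (-A.γ i) = ∞ := by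
          refine ENNReal.sum_eq_top.mpr ⟨b, Finset.mem_univ _, ?_⟩
          rw [hb, ENNReal.zero_rpow_of_neg (by linarith), ENNReal.mul_top hG]
        rw [h1, ENNReal.mul_top (zero_lt_one.trans hκ).ne', top_le_iff, ENNReal.rpow_neg,
          ENNReal.inv_eq_top, ENNReal.rpow_eq_zero_iff_of_pos hγ] at hle
        exact ha hle
    exact huniv.ge (Set.mem_univ j)
  · push Not at hs
    refine absurd hrad (not_le.mpr (specRad_lt_one_of_sum_lt
      (x := fun k => asymptoticRate c (i, k) ^ (-A.γ i)) (fun k => ?_) (fun k => ?_) fun k => ?_))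
    · rw [ENNReal.rpow_neg, Ne, ENNReal.inv_eq_zero, ENNReal.rpow_eq_top_iff_of_pos hγ]
      exact ((asymptoticRate_le_one hc.1 (i, k)).trans_lt ENNReal.one_lt_top).ne
    · rw [ENNReal.rpow_neg, Ne, ENNReal.inv_eq_top, ENNReal.rpow_eq_zero_iff_of_pos hγ]
      exact hs k
    · obtain ⟨κ, hκ, hle⟩ := A.exists_mul_sum_G_le hA hc i (hs k)
      have hx0 : asymptoticRate c (i, k) ^ (-A.γ i) ≠ 0 := by
        rw [ENNReal.rpow_neg, Ne, ENNReal.inv_eq_zero, ENNReal.rpow_eq_top_iff_of_pos hγ]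
        exact ((asymptoticRate_le_one hc.1 (i, k)).trans_lt ENNReal.one_lt_top).ne
      have hx : asymptoticRate c (i, k) ^ (-A.γ i) ≠ ∞ := by
        rw [ENNReal.rpow_neg, Ne, ENNReal.inv_eq_top, ENNReal.rpow_eq_zero_iff_of_pos hγ]
        exact hs k
      -- Multiplication by `κ > 1` is strict only on a nonzero finite sum; a zero sum is below the
      -- positive `x k` anyway.
      rcases eq_or_ne (∑ l, A.G i k l * asymptoticRate c (i, l) ^ (-A.γ i)) 0 with h0 | h0
      · rw [h0]
        exact pos_iff_ne_zero.mpr hx0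
      · have hfin : ∑ l, A.G i k l * asymptoticRate c (i, l) ^ (-A.γ i) ≠ ∞ := by
          intro h
          rw [h, ENNReal.mul_top (zero_lt_one.trans hκ).ne', top_le_iff] at hle
          exact hx hle
        refine lt_of_lt_of_le ?_ hle
        simpa using (ENNReal.mul_lt_mul_iff_left h0 hfin).mpr hκ

end RiskAversionModel

theorem theorem3p1 {N M : ℕ} {E : Type*} [MeasurableSpace E] (A : RiskAversionModel N M E)
    (hA : A.toSavingsProblem.StandingAssumption)
    (c : ℝ → Fin N × Fin M → ℝ) (hc : A.toSavingsProblem.IsOptimalConsumption c)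
    (i : Fin N)
    (h : (0 < ∑ l ∈ Finset.univ.filter (fun l => l < i), A.Pbar i l ∧
            ∀ z z', 0 < A.innov {ε | 0 < A.β z z' ε * A.R z z' ε}) ∨
          (0 < A.Pbar i i ∧ ¬ IsReducibleMatrix (A.G i) ∧ 1 ≤ specRad (A.G i))) :
    ∀ j : Fin M, Tendsto (fun w : ℝ => c w (i, j) / w) atTop (𝓝 0) := by
  intro j
  rcases h with ⟨hsum, hpos⟩ | ⟨-, hirr, hrad⟩
  · obtain ⟨l, hl, hPl⟩ := Finset.exists_lt_of_sum_lt (f := fun _ => (0 : ℝ)) (by simpa using hsum)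
    have hrow : 0 < ∑ k, A.Ptilde j k := by
      rw [Matrix.sum_row_of_mem_rowStochastic A.Ptilde_stochastic j]
      exact zero_lt_one
    obtain ⟨k, -, hk⟩ := Finset.exists_lt_of_sum_lt (f := fun _ => (0 : ℝ)) (by simpa using hrow)
    exact A.tendsto_zero_of_lower_risk_aversion hA hc (Finset.mem_filter.mp hl).2
      (k := k) (mul_pos hPl hk) (hpos _ _)
  · exact RiskAversionModel.tendsto_div_of_asymptoticRate_eq_zero hc.1
      (A.asymptoticRate_eq_zero hA hc hirr hrad j)
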